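/- Let $\mathcal P$ be a homogeneous Poisson process on $\mathbb R^3$ of intensity $1$, let $O$ be the origin, and let $d$ be either the Euclidean metric or the Johnson--Mehl metric, i.e. the metric induced by the norm $\|(x_1,x_2,t)\| = \sqrt{x_1^2+x_2^2}+|t|$ on $\mathbb R^3$. (i) For $A>0$ and $k\ge 1$ let $E_{k,A}$ be the event that $\mathcal P$ contains $k$ distinct points $P_1,\dots,P_k$ with the following property: there are points $Q_1,\dots,Q_k\in\mathbb R^3$ and real numbers $r_1,\dots,r_k$ with $0<r_i<Ak^{1/3}$ such that $d(O,Q_i)=d(P_i,Q_i)=r_i$ for every $1\le i\le k$, and $d(P_j,Q_i)\ge r_i$ for all $1\le i,j\le k$. Then for every constant $A>0$ and every constant $C$, $$\mathbb P(E_{k,A}) = o(e^{-Ck})\qquad\text{as } k\to\infty .$$ (ii) For $P\in\mathcal P\cup\{O\}$ let $V_P=\{x\in\mathbb R^3 : d(x,P)\le d(x,P')\text{ for all }P'\in\mathcal P\cup\{O\}\}$ be the cell of $P$ in the Voronoi tessellation of $\mathbb R^3$ with respect to the point set $\mathcal P\cup\{O\}$ and the metric $d$. Say that the cell $V_O$ of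 the origin has at least $k$ faces if there are at least $k$ points $P\in\mathcal P\setminus\{O\}$ whose cells $V_P$ meet $V_O$. Then for every constant $C$, the probability that $V_O$ has at least $k$ faces is $o(e^{-Ck})$ as $k\to\infty$. -/

import Mathlib

open MeasureTheory ProbabilityTheory Filter Topology Asymptotics

/-- `IsPoissonProcess X ν μ`: the random point set `X`, defined on a probability space with
measure `μ`, is a (simple) Poisson process with intensity measure `ν`. -/
structure IsPoissonProcess {Ω E : Type*} [MeasurableSpace Ω] [PseudoMetricSpace E]
    [MeasurableSpace E] (X : Ω → Set E) (ν : Measure E) (μ : Measure Ω) : Prop where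
  /-- Almost surely, only finitely many points lie in any given bounded set. -/
  locallyFinite : ∀ᵐ ω ∂μ, ∀ B : Set E, Bornology.IsBounded B → (X ω ∩ B).Finite
  /-- The number of points in a measurable set is a random variable. -/
  measurable_count : ∀ B : Set E, MeasurableSet B → Measurable fun ω => (X ω ∩ B).encard
  /-- The number of points in a set of finite `ν`-measure is Poisson with mean `ν B`. -/
  map_count : ∀ B : Set E, MeasurableSet B → ν B < ⊤ →
    μ.map (fun ω => (X ω ∩ B).encard) =
      (poissonMeasure (ν B).toNNReal).map (fun n : ℕ => (n : ℕ∞))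
  /-- The numbers of points in disjoint measurable sets are independent. -/
  indep_count : ∀ (n : ℕ) (B : Fin n → Set E), (∀ i, MeasurableSet (B i)) →
    Pairwise (Function.onFun Disjoint B) → iIndepFun (fun i ω => (X ω ∩ B i).encard) μ

/-- The Johnson--Mehl norm `√(x₁² + x₂²) + |t|` of a point `(x₁, x₂, t)` of `ℝ³`. -/
noncomputable def jmNorm (x : EuclideanSpace ℝ (Fin 3)) : ℝ :=
  √(x 0 ^ 2 + x 1 ^ 2) + |x 2|

/-- The Johnson--Mehl distance on `ℝ³`. -/
noncomputable def jmDist (x y : EuclideanSpace ℝ (Fin 3)) : ℝ := jmNorm (x - y)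

/-- The property of a point set `S` defining the event `E_{k,A}`: there are `k` distinct points
`P i` of `S`, points `Q i` and radii `0 < r i < A k^{1/3}` such that `Q i` is at distance `r i`
from both the origin and `P i`, and no `P j` is closer than `r i` to `Q i`. -/
def HasWitnessedPoints (d : EuclideanSpace ℝ (Fin 3) → EuclideanSpace ℝ (Fin 3) → ℝ)
    (A : ℝ) (k : ℕ) (S : Set (EuclideanSpace ℝ (Fin 3))) : Prop :=
  ∃ (P Q : Fin k → EuclideanSpace ℝ (Fin 3)) (r : Fin k → ℝ),
    Function.Injective P ∧ (∀ i, P i ∈ S) ∧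
    (∀ i, 0 < r i ∧ r i < A * (k : ℝ) ^ (1 / 3 : ℝ)) ∧
    (∀ i, d 0 (Q i) = r i ∧ d (P i) (Q i) = r i) ∧
    (∀ i j, r i ≤ d (P j) (Q i))

/-- The Voronoi cell of the site `z` with respect to the set of sites `S` and the metric `d`. -/
def voronoiCell {E : Type*} (d : E → E → ℝ) (S : Set E) (z : E) : Set E :=
  {x | ∀ z' ∈ S, d x z ≤ d x z'}

/-- The points `P ≠ O` of `S` whose cells share a face with the cell of the origin `O`, that is,
meet it, in the Voronoi tessellation of `ℝ³` with sites `S ∪ {O}`. The faces of the cell of the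
origin are indexed by these points. -/
def originFaces (d : EuclideanSpace ℝ (Fin 3) → EuclideanSpace ℝ (Fin 3) → ℝ)
    (S : Set (EuclideanSpace ℝ (Fin 3))) : Set (EuclideanSpace ℝ (Fin 3)) :=
  {P | P ∈ S ∧ P ≠ 0 ∧
    (voronoiCell d (insert 0 S) 0 ∩ voronoiCell d (insert 0 S) P).Nonempty}

/-! Rescale by `k^{1/3}`, so that the radii are below `A` and volumes shrink by `k`. The rescaled
points form a porous set: each is touched by a ball free of the others, with radius at least `ρ` if
the point is at distance at least `2ρ` from the origin. Hence at every scale up to `4ρ` each grid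
cell has one of its `16^3` children free of points (`IsWitnessed.exists_empty_child`), and `n`
refinements cut the volume of the occupied cells by `(4095/4096)^n`. So finitely many sets of volume
at most `η`, independent of `k`, suffice to cover every such configuration
(`exists_finite_cover_of_witnessed`). The event then forces `k` points into a set of volume at most
`ηk`; a union bound and Chernoff with small `η` beat any `e^{-Ck}`. For faces, either all witnessing
radii are below `A k^{1/3}`, or a ball of radius `A k^{1/3}` touching the origin is empty. The
latter has probability exponentially small in `k`, at a rate that grows with `A`. -/

/-- Chernoff bound for the upper tail of the Poisson distribution. -/
theorem poissonMeasure_Ici_le (r : NNReal) (t : ℝ) (ht : 0 ≤ t) (k : ℕ) :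
    poissonMeasure r (Set.Ici k) ≤
      ENNReal.ofReal (Real.exp (-t * k + r * (Real.exp t - 1))) := by
  have hsum : HasSum (fun n : ℕ => Real.exp (-r) * (r : ℝ) ^ n / n.factorial *
      Real.exp (t * n - t * k)) (Real.exp (-t * k + r * (Real.exp t - 1))) := by
    have h := (NormedSpace.expSeries_div_hasSum_exp ((r : ℝ) * Real.exp t)).mul_left
      (Real.exp (-r) * Real.exp (-t * k))
    rw [← Real.exp_eq_exp_ℝ] at h
    convert! h using 1
    · ext n
      rw [mul_pow, ← Real.exp_nat_mul, show t * n - t * k = -t * k + n * t by ring, Real.exp_add]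
      ring
    · rw [← Real.exp_add, ← Real.exp_add]
      congr 1
      ring
  rw [poissonMeasure, Measure.sum_apply _ (MeasurableSet.of_discrete), ← hsum.tsum_eq,
    ENNReal.ofReal_tsum_of_nonneg (fun n => by positivity) hsum.summable]
  refine ENNReal.tsum_le_tsum fun n => ?_
  rw [Measure.smul_apply, Measure.dirac_apply' _ MeasurableSet.of_discrete, smul_eq_mul]
  by_cases hn : k ≤ n
  · rw [Set.indicator_of_mem (by simpa using hn), Pi.one_apply, mul_one]
    refine ENNReal.ofReal_le_ofReal (le_mul_of_one_le_right (by positivity) ?_)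
    have : (k : ℝ) ≤ n := by exact_mod_cast hn
    exact Real.one_le_exp (by nlinarith)
  · rw [Set.indicator_of_notMem (by simpa using hn)]
    simp

namespace IsPoissonProcess

variable {Ω E : Type*} [MeasurableSpace Ω] [PseudoMetricSpace E] [MeasurableSpace E]
  {X : Ω → Set E} {ν : Measure E} {μ : Measure Ω}

theorem measure_encard_mem (hX : IsPoissonProcess X ν μ) {B : Set E} (hB : MeasurableSet B)
    (hν : ν B < ⊤) (S : Set ℕ∞) :
    μ {ω | (X ω ∩ B).encard ∈ S} =
      poissonMeasure (ν B).toNNReal ((fun n : ℕ => (n : ℕ∞)) ⁻¹' S) := by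
  have h := congrArg (fun m => m S) (hX.map_count B hB hν)
  beta_reduce at h
  rwa [Measure.map_apply (hX.measurable_count B hB) MeasurableSet.of_discrete,
    Measure.map_apply .of_discrete MeasurableSet.of_discrete] at h

theorem measure_le_encard_le (hX : IsPoissonProcess X ν μ) {B : Set E} (hB : MeasurableSet B)
    (hν : ν B < ⊤) (t : ℝ) (ht : 0 ≤ t) (k : ℕ) :
    μ {ω | (k : ℕ∞) ≤ (X ω ∩ B).encard} ≤
      ENNReal.ofReal (Real.exp (-t * k + (ν B).toReal * (Real.exp t - 1))) := by
  have h := hX.measure_encard_mem hB hν (Set.Ici (k : ℕ∞))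
  simp only [Set.mem_Ici] at h
  rw [h]
  convert! poissonMeasure_Ici_le (ν B).toNNReal t ht k using 2
  ext n
  simp

theorem measure_inter_eq_empty (hX : IsPoissonProcess X ν μ) {B : Set E} (hB : MeasurableSet B)
    (hν : ν B < ⊤) :
    μ {ω | X ω ∩ B = ∅} = ENNReal.ofReal (Real.exp (-(ν B).toReal)) := by
  have h := hX.measure_encard_mem hB hν {0}
  simp only [Set.mem_singleton_iff, Set.encard_eq_zero] at h
  rw [h, show ((fun n : ℕ => (n : ℕ∞)) ⁻¹' {0}) = {0} by ext; simp, poissonMeasure_singleton]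
  simp [ENNReal.toReal]

end IsPoissonProcess

/-! ### Cubic grids and their volumes -/

/-- The index of the cell containing `x` in the cubic grid of mesh `h`. -/
noncomputable def gridIndex (h : ℝ) (x : EuclideanSpace ℝ (Fin 3)) : Fin 3 → ℤ :=
  fun i => ⌊x i / h⌋

theorem measurable_gridIndex (h : ℝ) : Measurable (gridIndex h) := by
  refine measurable_pi_lambda _ fun i => ?_
  exact Int.measurable_floor.comp (by fun_prop)

theorem volume_gridIndex_preimage_singleton_le {h : ℝ} (hh : 0 < h) (v : Fin 3 → ℤ) :
    volume (gridIndex h ⁻¹' {v}) ≤ ENNReal.ofReal (h ^ 3) := by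
  have hsub : gridIndex h ⁻¹' {v} ⊆ (MeasurableEquiv.toLp 2 (Fin 3 → ℝ)).symm ⁻¹'
      (Set.univ.pi fun i => Set.Ico (v i * h : ℝ) (v i * h + h)) := by
    intro x hx i _
    have hi : ⌊x i / h⌋ = v i := congrFun hx i
    rw [Int.floor_eq_iff, le_div_iff₀ hh, div_lt_iff₀ hh] at hi
    exact ⟨hi.1, hi.2.trans_eq (by ring)⟩
  refine (measure_mono hsub).trans ?_
  rw [(EuclideanSpace.volume_preserving_symm_measurableEquiv_toLp (Fin 3)).measure_preimage_equiv,
    Real.volume_pi_Ico]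
  simp [ENNReal.ofReal_pow hh.le]

theorem volume_gridIndex_preimage_le {h : ℝ} (hh : 0 < h) (F : Finset (Fin 3 → ℤ)) :
    volume (gridIndex h ⁻¹' F) ≤ ENNReal.ofReal (F.card * h ^ 3) := by
  have hU : gridIndex h ⁻¹' F = ⋃ v ∈ F, gridIndex h ⁻¹' {v} := by
    ext x
    simp
  rw [hU]
  refine (measure_biUnion_finset_le _ _).trans ?_
  refine (Finset.sum_le_sum fun v _ => volume_gridIndex_preimage_singleton_le hh v).trans ?_
  rw [Finset.sum_const, nsmul_eq_mul, ENNReal.ofReal_mul (by positivity), ENNReal.ofReal_natCast]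

theorem gridIndex_mem_box {h R : ℝ} (hh : 0 < h) {x : EuclideanSpace ℝ (Fin 3)} (hx : ‖x‖ ≤ R) :
    gridIndex h x ∈ Fintype.piFinset fun _ : Fin 3 => Finset.Icc (-⌈R / h⌉) ⌈R / h⌉ := by
  refine Fintype.mem_piFinset.2 fun i => ?_
  have hi : |x i| ≤ R := (Real.norm_eq_abs _ ▸ PiLp.norm_apply_le x i).trans hx
  rw [abs_le] at hi
  rw [Finset.mem_Icc, ← Int.floor_neg, ← neg_div]
  exact ⟨Int.floor_mono (by gcongr; exact hi.1),
    (Int.floor_mono (by gcongr; exact hi.2)).trans (Int.floor_le_ceil _)⟩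

theorem gridIndex_eq_gridIndex_div (h : ℝ) (n : ℕ) (hn : n ≠ 0) (x : EuclideanSpace ℝ (Fin 3)) :
    gridIndex h x = fun i => gridIndex (h / n) x i / (n : ℤ) := by
  ext i
  have : x i / h = x i / (h / n) / n := by
    have : (n : ℝ) ≠ 0 := by exact_mod_cast hn
    rcases eq_or_ne h 0 with rfl | hh
    · simp
    · field_simp
  simp only [gridIndex]
  rw [this, Int.floor_div_natCast]

/-! ### Porosity of witnessed sets -/

/-- A set is witnessed at scale `ρ` with respect to `p` if each of its points lies on the boundary
of a `p`-ball of radius at least `ρ` whose interior misses the set. -/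
def IsWitnessed (p : Seminorm ℝ (EuclideanSpace ℝ (Fin 3))) (ρ : ℝ)
    (T : Set (EuclideanSpace ℝ (Fin 3))) : Prop :=
  ∀ P ∈ T, ∃ Q, ρ ≤ p (P - Q) ∧ ∀ P' ∈ T, p (P - Q) ≤ p (P' - Q)

theorem norm_le_seven_quarters_mul_of_abs_le {x : EuclideanSpace ℝ (Fin 3)} {a : ℝ} (ha : 0 ≤ a)
    (hx : ∀ i, |x i| ≤ a) : ‖x‖ ≤ 7 / 4 * a := by
  rw [EuclideanSpace.norm_eq, Fin.sum_univ_three]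
  refine Real.sqrt_le_iff.2 ⟨by positivity, ?_⟩
  have h : ∀ i, ‖x i‖ ^ 2 ≤ a ^ 2 := fun i => pow_le_pow_left₀ (norm_nonneg _) (hx i) 2
  nlinarith [h 0, h 1, h 2, sq_nonneg a]

/-- Every grid cell of small mesh contains a cell of the grid refined by the factor `16` that
misses a given witnessed set. -/
theorem IsWitnessed.exists_empty_child {p : Seminorm ℝ (EuclideanSpace ℝ (Fin 3))}
    (hp₁ : ∀ x, ‖x‖ ≤ p x) (hp₂ : ∀ x, p x ≤ 2 * ‖x‖) {ρ h : ℝ} (hh : 0 < h) (hρ : h ≤ 4 * ρ)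
    {T : Set (EuclideanSpace ℝ (Fin 3))} (hT : IsWitnessed p ρ T) (v : Fin 3 → ℤ) :
    ∃ w : Fin 3 → ℤ, (∀ i, w i / 16 = v i) ∧ w ∉ gridIndex (h / 16) '' T := by
  -- Try a central child first. If it contains a point `P`, moving `h/4` from `P` towards its
  -- witness `Q` stays inside the cell and enters the empty ball.
  by_cases hc : (fun i => 16 * v i + 8) ∈ gridIndex (h / 16) '' T
  swap
  · exact ⟨_, fun i => by omega, hc⟩
  obtain ⟨P, hPT, hP⟩ := hc
  obtain ⟨Q, hQ, hQT⟩ := hT P hPT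
  set r := p (P - Q) with hr
  have hr0 : 0 < r := by linarith
  set c : ℝ := h / 4 / r with hcdef
  have hc0 : 0 ≤ c := by positivity
  have hc1 : c ≤ 1 := by rw [hcdef, div_le_one hr0]; linarith
  have hcr : c * r = h / 4 := by rw [hcdef]; field_simp
  set P' := P + c • (Q - P) with hP'
  have hPP' : ‖P' - P‖ ≤ h / 4 := by
    have h1 : P' - P = (-c) • (P - Q) := by rw [hP']; module
    refine (hp₁ _).trans ?_
    rw [h1, map_smul_eq_mul, norm_neg, Real.norm_of_nonneg hc0, ← hr, hcr]
  have hP'Q : p (P' - Q) = r - h / 4 := by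
    have h1 : P' - Q = (1 - c) • (P - Q) := by rw [hP']; module
    rw [h1, map_smul_eq_mul, Real.norm_of_nonneg (by linarith), ← hr, ← hcr]
    ring
  refine ⟨gridIndex (h / 16) P', fun i => ?_, ?_⟩
  · have h1 : ⌊P i / (h / 16)⌋ = 16 * v i + 8 := congrFun hP i
    have h2 : |P' i - P i| ≤ h / 4 :=
      (Real.norm_eq_abs (P' i - P i) ▸ PiLp.norm_apply_le (P' - P) i).trans hPP'
    have h3 := congrFun (gridIndex_eq_gridIndex_div h 16 (by norm_num) P') i
    simp only [Nat.cast_ofNat] at h3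
    rw [← h3, gridIndex, Int.floor_eq_iff, le_div_iff₀ hh, div_lt_iff₀ hh]
    rw [Int.floor_eq_iff, le_div_iff₀ (by positivity), div_lt_iff₀ (by positivity)] at h1
    push_cast at h1
    rw [abs_le] at h2
    constructor <;> nlinarith [h1.1, h1.2, h2.1, h2.2]
  -- Points in one child differ by at most `2 * (7/4) * (h/16) = 7h/32` in `p`, less than the depth
  -- `h/4` of `P'` in the empty ball.
  · rintro ⟨y, hyT, hy⟩
    have h1 : ‖y - P'‖ ≤ 7 / 4 * (h / 16) := by
      refine norm_le_seven_quarters_mul_of_abs_le (by positivity) fun i => ?_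
      have h2 := Int.abs_sub_lt_one_of_floor_eq_floor (congrFun hy i)
      rw [← sub_div, abs_div, abs_of_pos (a := h / 16) (by positivity),
        div_lt_one (by positivity)] at h2
      exact h2.le
    have h2 : p (y - Q) ≤ p (y - P') + p (P' - Q) := by
      rw [← sub_add_sub_cancel y P' Q]
      exact map_add_le_add p _ _
    have h3 := hQT y hyT
    have h4 := hp₂ (y - P')
    linarith

/-- Of the `16^3 = 4096` children of each occupied cell, at least one is empty. -/
theorem IsWitnessed.card_image_gridIndex_le {p : Seminorm ℝ (EuclideanSpace ℝ (Fin 3))}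
    (hp₁ : ∀ x, ‖x‖ ≤ p x) (hp₂ : ∀ x, p x ≤ 2 * ‖x‖) {ρ h : ℝ} (hh : 0 < h) (hρ : h ≤ 4 * ρ)
    {T : Set (EuclideanSpace ℝ (Fin 3))} (hT : IsWitnessed p ρ T)
    {F F' : Finset (Fin 3 → ℤ)} (hF : (F : Set (Fin 3 → ℤ)) = gridIndex h '' T)
    (hF' : (F' : Set (Fin 3 → ℤ)) = gridIndex (h / 16) '' T) :
    F'.card ≤ 4095 * F.card := by
  classical
  have himg : F'.image (fun w i => w i / 16) ⊆ F := by
    rw [← Finset.coe_subset, Finset.coe_image, hF, hF', Set.image_image]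
    rintro _ ⟨x, hx, rfl⟩
    exact ⟨x, hx, by simpa using gridIndex_eq_gridIndex_div h 16 (by norm_num) x⟩
  refine (Finset.card_le_mul_card_image F' 4095 fun v _ => ?_).trans
    (Nat.mul_le_mul_left _ (Finset.card_le_card himg))
  obtain ⟨w, hwv, hw⟩ := hT.exists_empty_child hp₁ hp₂ hh hρ v
  have hsub : F'.filter (fun w => (fun i => w i / 16) = v) ⊆
      (Fintype.piFinset fun i => Finset.Ico (16 * v i) (16 * v i + 16)).erase w := by
    intro u hu
    rw [Finset.mem_filter] at hu
    refine Finset.mem_erase.2 ⟨?_, Fintype.mem_piFinset.2 fun i => ?_⟩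
    · rintro rfl
      exact hw (hF' ▸ Finset.mem_coe.2 hu.1)
    · have := congrFun hu.2 i
      beta_reduce at this
      rw [Finset.mem_Ico]
      omega
  refine (Finset.card_le_card hsub).trans ?_
  rw [Finset.card_erase_of_mem]
  · simp [Fintype.card_piFinset]
  · refine Fintype.mem_piFinset.2 fun i => ?_
    have := hwv i
    rw [Finset.mem_Ico]
    omega

theorem IsWitnessed.card_image_gridIndex_pow_le {p : Seminorm ℝ (EuclideanSpace ℝ (Fin 3))}
    (hp₁ : ∀ x, ‖x‖ ≤ p x) (hp₂ : ∀ x, p x ≤ 2 * ‖x‖) {ρ h : ℝ} (hh : 0 < h) (hρ : h ≤ 4 * ρ)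
    {T : Set (EuclideanSpace ℝ (Fin 3))} (hT : IsWitnessed p ρ T)
    {B : Finset (Fin 3 → ℤ)} (hB : gridIndex h '' T ⊆ B) (hbdd : Bornology.IsBounded T) (n : ℕ) :
    ∃ F : Finset (Fin 3 → ℤ), (F : Set (Fin 3 → ℤ)) = gridIndex (h / 16 ^ n) '' T ∧
      F.card ≤ 4095 ^ n * B.card := by
  obtain ⟨R, hR⟩ := hbdd.exists_norm_le
  have hfin : ∀ g : ℝ, 0 < g → (gridIndex g '' T).Finite := fun g hg =>
    (Finset.finite_toSet _).subset (Set.image_subset_iff.2 fun x hx => gridIndex_mem_box hg (hR x hx))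
  induction n with
  | zero =>
    refine ⟨(hfin h hh).toFinset, by simp, ?_⟩
    rw [pow_zero, one_mul]
    exact Finset.card_le_card (by simpa using hB)
  | succ n ih =>
    obtain ⟨F, hF, hcard⟩ := ih
    have hle : h / 16 ^ n ≤ h := div_le_self hh.le (one_le_pow₀ (by norm_num))
    have hF' : ((hfin (h / 16 ^ (n + 1)) (by positivity)).toFinset : Set (Fin 3 → ℤ)) =
        gridIndex (h / 16 ^ n / 16) '' T := by
      rw [Set.Finite.coe_toFinset, pow_succ, div_div]
    refine ⟨(hfin (h / 16 ^ (n + 1)) (by positivity)).toFinset, by simp, ?_⟩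
    refine (hT.card_image_gridIndex_le hp₁ hp₂ (by positivity) (hle.trans hρ) hF hF').trans ?_
    rw [pow_succ]
    linarith

/-! ### Finite covers by sets of small volume -/

/-- Witnessing balls may be tiny for points near the origin, so a small ball there is included
whole; elsewhere porosity applies. Finiteness holds because the cells all lie in a bounded box. -/
theorem exists_finite_cover_of_witnessed {p : Seminorm ℝ (EuclideanSpace ℝ (Fin 3))}
    (hp₁ : ∀ x, ‖x‖ ≤ p x) (hp₂ : ∀ x, p x ≤ 2 * ‖x‖) (A : ℝ) {η : ℝ} (hη : 0 < η) :
    ∃ 𝓖 : Set (Set (EuclideanSpace ℝ (Fin 3))), 𝓖.Finite ∧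
      (∀ G ∈ 𝓖, MeasurableSet G ∧ volume G ≤ ENNReal.ofReal η) ∧
      ∀ T : Set (EuclideanSpace ℝ (Fin 3)),
        (∀ P ∈ T, ∃ Q, p Q ≤ A ∧ p (P - Q) = p Q ∧ ∀ P' ∈ T, p (P - Q) ≤ p (P' - Q)) →
        ∃ G ∈ 𝓖, T ⊆ G := by
  classical
  -- The ball of radius `2ρ` has volume `32πρ^3/3`, at most `η/2` when `ρ ≤ 1` and `ρ ≤ η/100`.
  obtain ⟨ρ, hρ0, hρ1, hρη⟩ : ∃ ρ : ℝ, 0 < ρ ∧ ρ ≤ 1 ∧ ρ ≤ η / 100 :=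
    ⟨min 1 (η / 100), by positivity, min_le_left _ _, min_le_right _ _⟩
  set h : ℝ := 4 * ρ with hh
  have hh0 : 0 < h := by positivity
  set B : ℝ → Finset (Fin 3 → ℤ) := fun g =>
    Fintype.piFinset fun _ : Fin 3 => Finset.Icc (-⌈2 * A / g⌉) ⌈2 * A / g⌉ with hB
  obtain ⟨n, hn⟩ : ∃ n : ℕ, ((B h).card * h ^ 3) * (4095 / 4096 : ℝ) ^ n ≤ η / 2 := by
    have hlim := (tendsto_pow_atTop_nhds_zero_of_lt_one (r := (4095 / 4096 : ℝ)) (by norm_num)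
      (by norm_num)).const_mul ((B h).card * h ^ 3)
    rw [mul_zero] at hlim
    exact (hlim.eventually_le_const (by positivity)).exists
  refine ⟨(fun F : Finset (Fin 3 → ℤ) =>
      Metric.ball 0 (2 * ρ) ∪ gridIndex (h / 16 ^ n) ⁻¹' F) ''
      ((B (h / 16 ^ n)).powerset.filter fun F => F.card ≤ 4095 ^ n * (B h).card),
    (Finset.finite_toSet _).image _, ?_, fun T hT => ?_⟩
  · rintro _ ⟨F, hF, rfl⟩
    rw [Finset.mem_coe, Finset.mem_filter] at hF
    refine ⟨measurableSet_ball.union (measurable_gridIndex _ .of_discrete),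
      (measure_union_le _ _).trans ?_⟩
    rw [← add_halves η, ENNReal.ofReal_add (by positivity) (by positivity)]
    refine add_le_add ?_ ?_
    · rw [EuclideanSpace.volume_ball_fin_three, ← ENNReal.ofReal_pow (by positivity),
        ← ENNReal.ofReal_mul (by positivity)]
      refine ENNReal.ofReal_le_ofReal ?_
      have h1 : ρ ^ 3 ≤ ρ := pow_le_of_le_one hρ0.le hρ1 (by norm_num)
      have h2 := Real.pi_le_four
      have h3 : ρ ^ 3 * Real.pi ≤ ρ * 4 := by gcongr
      nlinarith
    · refine (volume_gridIndex_preimage_le (by positivity) F).trans (ENNReal.ofReal_le_ofReal ?_)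
      have h1 : (F.card : ℝ) ≤ 4095 ^ n * (B h).card := by exact_mod_cast hF.2
      calc (F.card : ℝ) * (h / 16 ^ n) ^ 3 ≤ 4095 ^ n * (B h).card * (h / 16 ^ n) ^ 3 := by gcongr
        _ = ((B h).card * h ^ 3) * (4095 / 4096 : ℝ) ^ n := by
          rw [div_pow, div_pow, ← pow_mul, mul_comm n 3, pow_mul]
          norm_num
          ring
        _ ≤ η / 2 := hn
  · have hnorm : ∀ P ∈ T, ‖P‖ ≤ 2 * A := fun P hP => by
      obtain ⟨Q, h1, h2, -⟩ := hT P hP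
      have h3 := map_add_le_add p (P - Q) Q
      rw [sub_add_cancel] at h3
      linarith [hp₁ P]
    -- Here `2ρ ≤ ‖P‖ ≤ p P ≤ 2 p Q`, so the radius is at least `ρ`.
    have hW : IsWitnessed p ρ (T \ Metric.ball 0 (2 * ρ)) := fun P hP => by
      obtain ⟨Q, h1, h2, h4⟩ := hT P hP.1
      have h3 := map_add_le_add p (P - Q) Q
      rw [sub_add_cancel] at h3
      have h5 : 2 * ρ ≤ ‖P‖ := by simpa using hP.2
      exact ⟨Q, by linarith [hp₁ P], fun P' hP' => h4 P' hP'.1⟩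
    have hbox : ∀ g, 0 < g → gridIndex g '' (T \ Metric.ball 0 (2 * ρ)) ⊆ B g := fun g hg =>
      Set.image_subset_iff.2 fun x hx => gridIndex_mem_box hg (hnorm x hx.1)
    obtain ⟨F, hF, hcard⟩ := hW.card_image_gridIndex_pow_le hp₁ hp₂ hh0 le_rfl (hbox h hh0)
      (isBounded_iff_forall_norm_le.2 ⟨2 * A, fun x hx => hnorm x hx.1⟩) n
    refine ⟨_, ⟨F, ?_, rfl⟩, fun x hx => ?_⟩
    · rw [Finset.mem_coe, Finset.mem_filter, Finset.mem_powerset, ← Finset.coe_subset, hF]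
      exact ⟨hbox _ (by positivity), hcard⟩
    · by_cases hx' : x ∈ Metric.ball 0 (2 * ρ)
      · exact Or.inl hx'
      · exact Or.inr (hF ▸ Set.mem_image_of_mem _ ⟨hx, hx'⟩)

/-- The argument uses only that the metric comes from a seminorm between `‖x‖` and `2‖x‖`. -/
theorem exists_seminorm_of_dist_or_jmDist
    {d : EuclideanSpace ℝ (Fin 3) → EuclideanSpace ℝ (Fin 3) → ℝ} (hd : d = dist ∨ d = jmDist) :
    ∃ p : Seminorm ℝ (EuclideanSpace ℝ (Fin 3)),
      (∀ x, ‖x‖ ≤ p x) ∧ (∀ x, p x ≤ 2 * ‖x‖) ∧ ∀ x y, d x y = p (x - y) := by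
  rcases hd with rfl | rfl
  · refine ⟨normSeminorm ℝ _, fun x => le_rfl, fun x => ?_, fun x y => dist_eq_norm x y⟩
    have := norm_nonneg x
    simp only [coe_normSeminorm]
    linarith
  · have hC : ∀ x : EuclideanSpace ℝ (Fin 3), jmNorm x = ‖(⟨x 0, x 1⟩ : ℂ)‖ + |x 2| := fun x => by
      rw [jmNorm, Complex.norm_def, Complex.normSq_mk, sq, sq]
    refine ⟨Seminorm.of jmNorm (fun x y => ?_) (fun a x => ?_), fun x => ?_, fun x => ?_,
      fun x y => rfl⟩
    · have h1 : (⟨(x + y) 0, (x + y) 1⟩ : ℂ) = ⟨x 0, x 1⟩ + ⟨y 0, y 1⟩ := rfl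
      rw [hC, hC, hC, h1, PiLp.add_apply]
      linarith [norm_add_le (⟨x 0, x 1⟩ : ℂ) ⟨y 0, y 1⟩, abs_add_le (x 2) (y 2)]
    · have h1 : (⟨(a • x) 0, (a • x) 1⟩ : ℂ) = a • ⟨x 0, x 1⟩ := by
        apply Complex.ext <;> simp
      rw [hC, hC, h1, PiLp.smul_apply, norm_smul, smul_eq_mul, abs_mul, Real.norm_eq_abs]
      ring
    · change ‖x‖ ≤ jmNorm x
      rw [jmNorm, EuclideanSpace.norm_eq, Fin.sum_univ_three]
      refine Real.sqrt_le_iff.2 ⟨by positivity, ?_⟩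
      simp only [Real.norm_eq_abs, sq_abs]
      have h1 := Real.sq_sqrt (by positivity : 0 ≤ x 0 ^ 2 + x 1 ^ 2)
      have h2 : 0 ≤ √(x 0 ^ 2 + x 1 ^ 2) * |x 2| := by positivity
      nlinarith [sq_abs (x 2)]
    · change jmNorm x ≤ 2 * ‖x‖
      have h1 : √(x 0 ^ 2 + x 1 ^ 2) ≤ ‖x‖ := by
        rw [EuclideanSpace.norm_eq, Fin.sum_univ_three]
        refine Real.sqrt_le_sqrt ?_
        simp only [Real.norm_eq_abs, sq_abs]
        linarith [sq_nonneg (x 2)]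
      have h2 : |x 2| ≤ ‖x‖ := Real.norm_eq_abs (x 2) ▸ PiLp.norm_apply_le x 2
      rw [jmNorm]
      linarith

theorem isLittleO_exp_of_le {f : ℕ → ℝ} {M C : ℝ} (hf₀ : ∀ k, 0 ≤ f k)
    (hf : ∀ᶠ k : ℕ in atTop, f k ≤ M * Real.exp (-(C + 1) * k)) :
    f =o[atTop] fun k : ℕ => Real.exp (-C * k) := by
  have hO : f =O[atTop] fun k : ℕ => Real.exp (-(C + 1) * k) := by
    refine IsBigO.of_bound M (hf.mono fun k hk => ?_)
    rwa [Real.norm_of_nonneg (hf₀ k), Real.norm_of_nonneg (Real.exp_pos _).le]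
  refine hO.trans_isLittleO (Real.isLittleO_exp_comp_exp_comp.2 ?_)
  refine tendsto_natCast_atTop_atTop.congr fun k => ?_
  ring

/-! ### Probability estimates -/

section

open scoped Pointwise

/-- Scaling by `k^{1/3}` multiplies volumes by `k`. -/
theorem volume_rpow_smul (k : ℕ) (G : Set (EuclideanSpace ℝ (Fin 3))) :
    volume (((k : ℝ) ^ (1 / 3 : ℝ)) • G) = k * volume G := by
  have h3 : ((k : ℝ) ^ (1 / 3 : ℝ)) ^ 3 = k := by
    rw [← Real.rpow_natCast, ← Real.rpow_mul (by positivity)]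
    norm_num
  rw [Measure.addHaar_smul, finrank_euclideanSpace_fin, h3, abs_of_nonneg (by positivity),
    ENNReal.ofReal_natCast]

variable {p : Seminorm ℝ (EuclideanSpace ℝ (Fin 3))}
  {d : EuclideanSpace ℝ (Fin 3) → EuclideanSpace ℝ (Fin 3) → ℝ}

theorem HasWitnessedPoints.le_encard_inter (hpd : ∀ x y, d x y = p (x - y)) {A : ℝ} {k : ℕ}
    (hk : k ≠ 0) {S : Set (EuclideanSpace ℝ (Fin 3))} (hS : HasWitnessedPoints d A k S)
    {𝓖 : Set (Set (EuclideanSpace ℝ (Fin 3)))}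
    (h𝓖 : ∀ T : Set (EuclideanSpace ℝ (Fin 3)),
        (∀ P ∈ T, ∃ Q, p Q ≤ A ∧ p (P - Q) = p Q ∧ ∀ P' ∈ T, p (P - Q) ≤ p (P' - Q)) →
        ∃ G ∈ 𝓖, T ⊆ G) :
    ∃ G ∈ 𝓖, (k : ℕ∞) ≤ (S ∩ ((k : ℝ) ^ (1 / 3 : ℝ)) • G).encard := by
  obtain ⟨P, Q, r, hP, hPS, hr, heq, hle⟩ := hS
  set s : ℝ := (k : ℝ) ^ (1 / 3 : ℝ) with hs
  have hs0 : 0 < s := by positivity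
  have hsp : ∀ x, p (s⁻¹ • x) = s⁻¹ * p x := fun x => by
    rw [map_smul_eq_mul, Real.norm_of_nonneg (by positivity)]
  simp only [hpd, zero_sub, map_neg_eq_map] at heq hle
  obtain ⟨G, hG, hTG⟩ := h𝓖 (Set.range fun i => s⁻¹ • P i) (by
    rintro _ ⟨i, rfl⟩
    refine ⟨s⁻¹ • Q i, ?_, ?_, ?_⟩
    · rw [hsp, (heq i).1, inv_mul_le_iff₀ hs0, mul_comm]
      exact (hr i).2.le
    · rw [← smul_sub, hsp, hsp, (heq i).1, (heq i).2]
    · rintro _ ⟨j, rfl⟩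
      rw [← smul_sub, ← smul_sub, hsp, hsp, (heq i).2]
      have := hle i j
      gcongr)
  refine ⟨G, hG, ?_⟩
  have hsub : Set.range P ⊆ S ∩ s • G := by
    rintro _ ⟨i, rfl⟩
    exact ⟨hPS i, (Set.mem_smul_set_iff_inv_smul_mem₀ hs0.ne' _ _).2 (hTG ⟨i, rfl⟩)⟩
  refine le_trans ?_ (Set.encard_le_encard hsub)
  rw [← Set.image_univ, hP.encard_image, Set.encard_univ]
  simp

variable {Ω : Type*} [MeasurableSpace Ω] {μ : Measure Ω} [IsProbabilityMeasure μ]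
  {X : Ω → Set (EuclideanSpace ℝ (Fin 3))}

theorem exists_measureReal_hasWitnessedPoints_le (hp₁ : ∀ x, ‖x‖ ≤ p x)
    (hp₂ : ∀ x, p x ≤ 2 * ‖x‖) (hpd : ∀ x y, d x y = p (x - y))
    (hX : IsPoissonProcess X volume μ) (A C : ℝ) :
    ∃ M : ℝ, ∀ k : ℕ, k ≠ 0 →
      μ.real {ω | HasWitnessedPoints d A k (X ω)} ≤ M * Real.exp (-(C + 1) * k) := by
  -- With volume at most `k e^{-t}`, the Chernoff exponent is at most `-tk + k = -(|C| + 1)k`.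
  set t : ℝ := |C| + 2 with ht
  have ht0 : 0 ≤ t := by positivity
  obtain ⟨𝓖, hfin, hvol, h𝓖⟩ :=
    exists_finite_cover_of_witnessed hp₁ hp₂ A (Real.exp_pos (-t))
  refine ⟨hfin.toFinset.card, fun k hk => ?_⟩
  set s : ℝ := (k : ℝ) ^ (1 / 3 : ℝ) with hs
  have hsub : {ω | HasWitnessedPoints d A k (X ω)} ⊆
      ⋃ G ∈ hfin.toFinset, {ω | (k : ℕ∞) ≤ (X ω ∩ s • G).encard} := fun ω hω => by
    obtain ⟨G, hG, hle⟩ := HasWitnessedPoints.le_encard_inter hpd hk hω h𝓖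
    exact Set.mem_biUnion (hfin.mem_toFinset.2 hG) hle
  refine (measureReal_mono hsub (measure_ne_top _ _)).trans ((measureReal_biUnion_finset_le _ _).trans ?_)
  rw [← nsmul_eq_mul]
  refine Finset.sum_le_card_nsmul _ _ _ fun G hG => ?_
  obtain ⟨hGm, hGv⟩ := hvol G (hfin.mem_toFinset.1 hG)
  have hs0 : s ≠ 0 := by positivity
  have hv : volume (s • G) ≤ ENNReal.ofReal (k * Real.exp (-t)) := by
    rw [volume_rpow_smul, ENNReal.ofReal_mul (by positivity), ENNReal.ofReal_natCast]
    gcongr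
  refine ENNReal.toReal_le_of_le_ofReal (by positivity)
    ((hX.measure_le_encard_le (hGm.const_smul₀ s) (hv.trans_lt ENNReal.ofReal_lt_top)
      t ht0 k).trans (ENNReal.ofReal_le_ofReal (Real.exp_le_exp.2 ?_)))
  have h1 : (volume (s • G)).toReal ≤ k * Real.exp (-t) :=
    ENNReal.toReal_le_of_le_ofReal (by positivity) hv
  have h2 : (volume (s • G)).toReal * (Real.exp t - 1) ≤ k * Real.exp (-t) * (Real.exp t - 1) :=
    mul_le_mul_of_nonneg_right h1 (by linarith [Real.one_le_exp ht0])
  have h3 : Real.exp (-t) * Real.exp t = 1 := by rw [← Real.exp_add]; simp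
  have h4 : k * Real.exp (-t) * (Real.exp t - 1) = k - k * Real.exp (-t) := by
    linear_combination (k : ℝ) * h3
  have h5 : 0 ≤ k * Real.exp (-t) := by positivity
  have h6 : C * k ≤ |C| * k := by gcongr; exact le_abs_self C
  rw [ht] at *
  nlinarith

/-- If the cell of the origin has many faces, then either these are witnessed by small balls or
there is a large ball with the origin on its boundary whose interior misses the point set. -/
theorem hasWitnessedPoints_or_exists_empty_ball (hp₁ : ∀ x, ‖x‖ ≤ p x)
    (hpd : ∀ x y, d x y = p (x - y)) {A : ℝ} (hA : 0 < A) {k : ℕ} (hk : k ≠ 0)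
    {S : Set (EuclideanSpace ℝ (Fin 3))} (hS : (k : ℕ∞) ≤ (originFaces d S).encard) :
    HasWitnessedPoints d A k S ∨
      ∃ u, p u = A ∧ ∀ x ∈ S, (k : ℝ) ^ (1 / 3 : ℝ) * A ≤ p (x - (k : ℝ) ^ (1 / 3 : ℝ) • u) := by
  set s : ℝ := (k : ℝ) ^ (1 / 3 : ℝ) with hs
  have hs0 : 0 < s := by positivity
  obtain ⟨F, hFS, hFk⟩ := Set.exists_subset_encard_eq hS
  have hFfin : F.Finite := Set.finite_of_encard_eq_coe hFk
  have : Finite F := hFfin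
  have hcard : Nat.card F = k := by
    rw [Nat.card_coe_set_eq, Set.ncard, hFk, ENat.toNat_natCast]
  let e : Fin k ≃ F := (Finite.equivFinOfCardEq hcard).symm
  have hface : ∀ i, ∃ x, p x = p ((e i : EuclideanSpace ℝ (Fin 3)) - x) ∧
      (∀ z ∈ S, p x ≤ p (z - x)) ∧ 0 < p x := fun i => by
    obtain ⟨hPS, hP0, x, hx0, hxP⟩ := hFS (e i).2
    have h0 : ∀ z ∈ insert 0 S, p x ≤ p (x - z) := fun z hz => by
      simpa [hpd] using hx0 z hz
    have h1 : ∀ z ∈ insert 0 S, p (x - e i) ≤ p (x - z) := fun z hz => by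
      simpa [hpd] using hxP z hz
    have heq : p x = p (x - e i) :=
      le_antisymm (h0 _ (Set.mem_insert_of_mem _ hPS)) (by simpa using h1 0 (Set.mem_insert _ _))
    refine ⟨x, by rw [heq, map_sub_rev], fun z hz => ?_, ?_⟩
    · rw [map_sub_rev]
      exact h0 z (Set.mem_insert_of_mem _ hz)
    · by_contra hneg
      have hx : x = 0 := norm_le_zero_iff.1 ((hp₁ x).trans (not_lt.1 hneg))
      have hxe : x - e i = 0 := norm_le_zero_iff.1 ((hp₁ _).trans (heq ▸ not_lt.1 hneg))
      exact hP0 ((sub_eq_zero.1 hxe).symm.trans hx)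
  choose Q hQ hQS hQ0 using hface
  by_cases hbig : ∃ i, A * s ≤ p (Q i)
  · obtain ⟨i, hi⟩ := hbig
    right
    set r := p (Q i) with hr
    have hr0 : 0 < r := hQ0 i
    have hpu : p ((A / r) • Q i) = A := by
      rw [map_smul_eq_mul, Real.norm_of_nonneg (by positivity), ← hr]
      field_simp
    -- Shrinking the ball towards the origin gives a ball of radius `sA` inside it, still touching
    -- the origin.
    refine ⟨(A / r) • Q i, hpu, fun x hx => ?_⟩
    have h1 := map_add_le_add p (x - s • (A / r) • Q i) (s • (A / r) • Q i - Q i)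
    rw [sub_add_sub_cancel] at h1
    have h2 : p (s • (A / r) • Q i - Q i) = r - s * A := by
      have h3 : s • (A / r) • Q i - Q i = (s * (A / r) - 1) • Q i := by module
      have h4 : s * (A / r) ≤ 1 := by
        rw [← mul_div_assoc, div_le_one hr0]
        linarith
      rw [h3, map_smul_eq_mul, Real.norm_of_nonpos (by linarith), ← hr]
      field_simp
      ring
    linarith [hQS i x hx]
  · push Not at hbig
    left
    refine ⟨fun i => e i, Q, fun i => p (Q i), Subtype.val_injective.comp e.injective,
      fun i => (hFS (e i).2).1, fun i => ⟨hQ0 i, hbig i⟩, fun i => ⟨?_, ?_⟩, fun i j => ?_⟩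
    · rw [hpd, zero_sub, map_neg_eq_map]
    · rw [hpd, ← hQ]
    · rw [hpd]
      exact hQS i _ (hFS (e j).2).1

/-- The centres `u` of possible empty balls lie in a compact set, so a finite net of smaller balls
reduces their emptiness to a union bound. -/
theorem exists_measureReal_originFaces_le (hp₁ : ∀ x, ‖x‖ ≤ p x)
    (hp₂ : ∀ x, p x ≤ 2 * ‖x‖) (hpd : ∀ x y, d x y = p (x - y))
    (hX : IsPoissonProcess X volume μ) (C : ℝ) :
    ∃ M : ℝ, ∀ k : ℕ, k ≠ 0 →
      μ.real {ω | (k : ℕ∞) ≤ (originFaces d (X ω)).encard} ≤ M * Real.exp (-(C + 1) * k) := by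
  -- A net ball of radius `b` near `u` lies within `2b` of `u`, hence in the `p`-ball of radius
  -- `4b`. Its volume exceeds `b ≥ C + 1`.
  set b : ℝ := |C| + 1 with hb
  have hb1 : 1 ≤ b := by linarith [abs_nonneg C]
  obtain ⟨M, hM⟩ := exists_measureReal_hasWitnessedPoints_le hp₁ hp₂ hpd hX (4 * b) C
  obtain ⟨N, -, hNfin, hN⟩ := finite_cover_balls_of_compact
    (isCompact_closedBall (0 : EuclideanSpace ℝ (Fin 3)) (4 * b)) (by positivity : 0 < b)
  refine ⟨M + hNfin.toFinset.card, fun k hk => ?_⟩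
  set s : ℝ := (k : ℝ) ^ (1 / 3 : ℝ) with hs
  have hs0 : 0 < s := by positivity
  have hsub : {ω | (k : ℕ∞) ≤ (originFaces d (X ω)).encard} ⊆
      {ω | HasWitnessedPoints d (4 * b) k (X ω)} ∪
        ⋃ c ∈ hNfin.toFinset, {ω | X ω ∩ s • Metric.ball c b = ∅} := fun ω hω => by
    refine (hasWitnessedPoints_or_exists_empty_ball hp₁ hpd (by positivity) hk hω).imp id ?_
    rintro ⟨u, hu, hempty⟩
    obtain ⟨c, hcN, hc⟩ := Set.mem_iUnion₂.1 (hN (by simpa [hu] using hp₁ u :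
      u ∈ Metric.closedBall 0 (4 * b)))
    refine Set.mem_biUnion (hNfin.mem_toFinset.2 hcN) (Set.eq_empty_iff_forall_notMem.2 ?_)
    rintro _ ⟨hx, y, hy, rfl⟩
    have h1 := hempty _ hx
    simp only [← hs] at h1
    rw [← smul_sub, map_smul_eq_mul, Real.norm_of_nonneg hs0.le, mul_le_mul_iff_right₀ hs0] at h1
    have h2 := hp₂ (y - u)
    have h3 : ‖y - u‖ < 2 * b := by
      rw [← dist_eq_norm]
      have := dist_triangle_right y u c
      rw [Metric.mem_ball] at hy hc
      linarith
    linarith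
  refine (measureReal_mono hsub (measure_ne_top _ _)).trans ((measureReal_union_le _ _).trans ?_)
  rw [add_mul]
  refine add_le_add (hM k hk) ((measureReal_biUnion_finset_le _ _).trans ?_)
  rw [← nsmul_eq_mul]
  refine Finset.sum_le_card_nsmul _ _ _ fun c _ => ?_
  have hv : volume (s • Metric.ball c b) = ENNReal.ofReal (k * (b ^ 3 * (Real.pi * 4 / 3))) := by
    rw [volume_rpow_smul, EuclideanSpace.volume_ball_fin_three, ENNReal.ofReal_mul (by positivity),
      ENNReal.ofReal_natCast, ENNReal.ofReal_mul (by positivity), ENNReal.ofReal_pow (by positivity)]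
  rw [Measure.real, hX.measure_inter_eq_empty (measurableSet_ball.const_smul₀ s)
    (hv ▸ ENNReal.ofReal_lt_top), ENNReal.toReal_ofReal (by positivity), hv,
    ENNReal.toReal_ofReal (by positivity), Real.exp_le_exp, neg_mul, neg_le_neg_iff,
    mul_comm]
  have h1 : b ≤ b ^ 3 := le_self_pow₀ hb1 (by norm_num)
  have h2 : b ^ 3 ≤ b ^ 3 * (Real.pi * 4 / 3) :=
    le_mul_of_one_le_right (by positivity) (by linarith [Real.pi_gt_three])
  have h3 : C + 1 ≤ b := by linarith [le_abs_self C]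
  gcongr
  linarith

end

theorem mainTheorem5 {Ω : Type*} [MeasurableSpace Ω] (μ : Measure Ω) [IsProbabilityMeasure μ]
    (X : Ω → Set (EuclideanSpace ℝ (Fin 3)))
    (hX : IsPoissonProcess X (volume : Measure (EuclideanSpace ℝ (Fin 3))) μ)
    (d : EuclideanSpace ℝ (Fin 3) → EuclideanSpace ℝ (Fin 3) → ℝ)
    (hd : d = dist ∨ d = jmDist) :
    (∀ A C : ℝ, 0 < A →
      (fun k : ℕ => μ.real {ω | HasWitnessedPoints d A k (X ω)})
        =o[atTop] fun k : ℕ => Real.exp (-C * k)) ∧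
    (∀ C : ℝ,
      (fun k : ℕ => μ.real {ω | (k : ℕ∞) ≤ (originFaces d (X ω)).encard})
        =o[atTop] fun k : ℕ => Real.exp (-C * k)) := by
  obtain ⟨p, hp₁, hp₂, hpd⟩ := exists_seminorm_of_dist_or_jmDist hd
  refine ⟨fun A C _ => ?_, fun C => ?_⟩
  · obtain ⟨M, hM⟩ := exists_measureReal_hasWitnessedPoints_le hp₁ hp₂ hpd hX A C
    exact isLittleO_exp_of_le (fun k => measureReal_nonneg)
      ((eventually_ne_atTop 0).mono fun k hk => hM k hk)
  · obtain ⟨M, hM⟩ := exists_measureReal_originFaces_le hp₁ hp₂ hpd hX C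
    exact isLittleO_exp_of_le (fun k => measureReal_nonneg)
      ((eventually_ne_atTop 0).mono fun k hk => hM k hk)
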